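/- Let $\{\alpha_n\}_{n=0}^{\infty}$ be complex numbers with $|\alpha_n|<1$ for all $n\ge 0$, and let $\mu$ be a nontrivial (that is, infinitely supported) finite positive Borel measure on the unit circle $\mathbb{T}=\{|z|=1\}$ whose Verblunsky coefficients are $\{\alpha_n\}$; that is, $\alpha_n=-\overline{\Phi_{n+1}(0)}$ for $n\ge 0$, where $\Phi_n$ is the monic polynomial of degree $n$ and $\int_{\mathbb{T}}\Phi_n\overline{\Phi_m}\,d\mu=0$ for $n\ne m$. Put $$\tau_0=1,\qquad \tau_n=\frac{\tau_{n-1}-\overline{\alpha_{n-1}}}{1-\tau_{n-1}\alpha_{n-1}},\qquad c_n=\frac{-\operatorname{Im}(\tau_{n-1}\alpha_{n-1})}{1-\operatorname{Re}(\tau_{n-1}\alpha_{n-1})}\qquad(n\ge 1),$$ and let $\mathcal{A}[\vartheta_1,\vartheta_2]=\{e^{i\theta}:\vartheta_1\le\theta\le\vartheta_2\}$, with the conventions $\cot 0=+\infty$ and $\cot\pi=-\infty$. (a) Suppose $c_n+c_{n+1}>0$ for all $n\ge 1$. If $0<\vartheta_2\le 2\pi$ and $$\cot(\vartheta_2/2)\le\frac{c_nc_{n+1}-1}{c_n+c_{n+1}}\qquad\text{for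 all } n\ge 1,$$ then $\operatorname{supp}\mu\subseteq\mathcal{A}[0,\vartheta_2]$. (b) Suppose $c_n+c_{n+1}<0$ for all $n\ge 1$. If $0\le\vartheta_1<2\pi$ and $$\frac{c_nc_{n+1}-1}{c_n+c_{n+1}}\le\cot(\vartheta_1/2)\qquad\text{for all } n\ge 1,$$ then $\operatorname{supp}\mu\subseteq\mathcal{A}[\vartheta_1,2\pi]$. -/

import Mathlib

open MeasureTheory Polynomial
open scoped ComplexConjugate

noncomputable section

namespace OPUC

/-- `Φ` is the sequence of monic orthogonal polynomials of the measure `μ`, which will be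
a measure on `ℂ` that is carried by the unit circle. -/
structure IsMonicOPUC (μ : Measure ℂ) (Φ : ℕ → ℂ[X]) : Prop where
  monic : ∀ n, (Φ n).Monic
  natDegree_eq : ∀ n, (Φ n).natDegree = n
  orthogonal : ∀ n m, n ≠ m →
    ∫ z, (Φ n).eval z * conj ((Φ m).eval z) ∂μ = 0

/-- The numbers `α 0, α 1, …` are the Verblunsky coefficients of `μ`:
`α n` is minus the conjugate of the value at `0` of the monic orthogonal polynomial of
degree `n + 1`. -/
def HasVerblunskyCoefficients (μ : Measure ℂ) (α : ℕ → ℂ) : Prop :=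
  ∃ Φ : ℕ → ℂ[X], IsMonicOPUC μ Φ ∧ ∀ n, α n = -conj ((Φ (n + 1)).eval 0)

/-- The unimodular numbers `τ 0 = 1`,
`τ (n + 1) = (τ n - conj (α n)) / (1 - τ n * α n)`. -/
def tau (α : ℕ → ℂ) : ℕ → ℂ
  | 0 => 1
  | n + 1 => (tau α n - conj (α n)) / (1 - tau α n * α n)

/-- The real numbers `c₁, c₂, …`, numbered from zero: `cCoeff α n` is `cₙ₊₁`. -/
def cCoeff (α : ℕ → ℂ) (n : ℕ) : ℝ :=
  -(tau α n * α n).im / (1 - (tau α n * α n).re)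

/-- The closed arc of all `exp (i θ)` with `ϑ₁ ≤ θ ≤ ϑ₂`. -/
def closedArc (ϑ₁ ϑ₂ : ℝ) : Set ℂ :=
  {z | ∃ θ : ℝ, ϑ₁ ≤ θ ∧ θ ≤ ϑ₂ ∧ z = Complex.exp (θ * Complex.I)}

end OPUC

end

/-! Let `Pₙ = zΦₙ - τₙΦₙ*`. It is orthogonal to `z, …, zⁿ` and all its zeros are unimodular. These
are simple and carry a positive quadrature formula for `|q|²`, `deg q ≤ n`. Testing it on `(z +
z₀)ⁿ`, whose modulus on the circle peaks at `z₀`, shows that a point of the support cannot stay at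
positive distance from the zeros of every `Pₙ` (`support_subset_of_zeros_subset`).

It remains to keep the zeros off the gap. For `z = (t + i)/(t - i)`, `t = cot(θ/2)`, write
`zΦₙ/(τₙΦₙ*) = (y + i)/(y - i)`; a zero of `Pₙ` means `y = ∞`. The Szegő recurrence becomes a
Riccati recurrence for `δ = t - y`. The hypothesis on `t` says `(t - cₙ)(t - cₙ₊₁) ≥ 1 + t²`, and a
chain sequence comparison then keeps `δ/(t - cₙ)` in `[0, 1]` (`riccati_bound`), so `y` stays
finite. -/

namespace OPUC

/-! ### The `L²(μ)` form on polynomials. -/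

section Form

variable {μ : Measure ℂ}

/-- The sesquilinear form of `L²(μ)` on polynomials. -/
noncomputable def form (μ : Measure ℂ) (p q : ℂ[X]) : ℂ :=
  ∫ z, p.eval z * conj (q.eval z) ∂μ

theorem integrable_of_continuous [IsFiniteMeasure μ] {E : Type*} [NormedAddCommGroup E]
    (hμ : ∀ᵐ z ∂μ, ‖z‖ = 1) {f : ℂ → E} (hf : Continuous f) : Integrable f μ := by
  obtain ⟨C, hC⟩ := (isCompact_sphere (0 : ℂ) 1).exists_bound_of_continuousOn hf.continuousOn
  refine Integrable.of_bound hf.aestronglyMeasurable C ?_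
  filter_upwards [hμ] with z hz
  exact hC z (by simpa using hz)

theorem integrable_form [IsFiniteMeasure μ] (hμ : ∀ᵐ z ∂μ, ‖z‖ = 1) (p q : ℂ[X]) :
    Integrable (fun z => p.eval z * conj (q.eval z)) μ :=
  integrable_of_continuous hμ (p.continuous.mul (Complex.continuous_conj.comp q.continuous))

theorem form_add_left [IsFiniteMeasure μ] (hμ : ∀ᵐ z ∂μ, ‖z‖ = 1) (p q r : ℂ[X]) :
    form μ (p + q) r = form μ p r + form μ q r := by
  unfold form
  rw [← integral_add (integrable_form hμ p r) (integrable_form hμ q r)]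
  simp [add_mul]

theorem form_C_mul_left (c : ℂ) (p q : ℂ[X]) : form μ (C c * p) q = c * form μ p q := by
  unfold form
  rw [← integral_const_mul]
  simp [mul_assoc]

theorem form_conj (p q : ℂ[X]) : conj (form μ p q) = form μ q p := by
  unfold form
  rw [← integral_conj]
  simp [mul_comm]

theorem form_add_right [IsFiniteMeasure μ] (hμ : ∀ᵐ z ∂μ, ‖z‖ = 1) (p q r : ℂ[X]) :
    form μ p (q + r) = form μ p q + form μ p r := by
  rw [← form_conj, form_add_left hμ, map_add, form_conj, form_conj]

theorem form_C_mul_right (c : ℂ) (p q : ℂ[X]) :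
    form μ p (C c * q) = conj c * form μ p q := by
  rw [← form_conj, form_C_mul_left, map_mul, form_conj]

theorem form_sub_left [IsFiniteMeasure μ] (hμ : ∀ᵐ z ∂μ, ‖z‖ = 1) (p q r : ℂ[X]) :
    form μ (p - q) r = form μ p r - form μ q r := by
  have := form_add_left hμ (p - q) q r
  rw [sub_add_cancel] at this
  rw [this, add_sub_cancel_right]

theorem form_zero_right (p : ℂ[X]) : form μ p 0 = 0 := by simp [form]

theorem form_sum_left [IsFiniteMeasure μ] (hμ : ∀ᵐ z ∂μ, ‖z‖ = 1) {ι : Type*} (s : Finset ι)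
    (f : ι → ℂ[X]) (r : ℂ[X]) : form μ (∑ i ∈ s, f i) r = ∑ i ∈ s, form μ (f i) r := by
  unfold form
  rw [← integral_finsetSum _ fun i _ => integrable_form hμ (f i) r]
  simp [eval_finsetSum, Finset.sum_mul]

theorem form_sum_right [IsFiniteMeasure μ] (hμ : ∀ᵐ z ∂μ, ‖z‖ = 1) {ι : Type*} (s : Finset ι)
    (f : ι → ℂ[X]) (r : ℂ[X]) : form μ r (∑ i ∈ s, f i) = ∑ i ∈ s, form μ r (f i) := by
  rw [← form_conj, form_sum_left hμ, map_sum]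
  simp_rw [form_conj]

theorem form_congr (hμ : ∀ᵐ z ∂μ, ‖z‖ = 1) {p q r s : ℂ[X]}
    (h : ∀ z : ℂ, ‖z‖ = 1 → p.eval z * conj (q.eval z) = r.eval z * conj (s.eval z)) :
    form μ p q = form μ r s := by
  refine integral_congr_ae ?_
  filter_upwards [hμ] with z hz using h z hz

theorem conj_mul_self_of_norm_eq_one {z : ℂ} (hz : ‖z‖ = 1) : conj z * z = 1 := by
  rw [Complex.conj_mul', hz]; simp

theorem form_X_mul_X_mul (hμ : ∀ᵐ z ∂μ, ‖z‖ = 1) (p q : ℂ[X]) :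
    form μ (X * p) (X * q) = form μ p q := by
  refine form_congr hμ fun z hz => ?_
  simp only [eval_mul, eval_X, map_mul]
  linear_combination p.eval z * conj (q.eval z) * conj_mul_self_of_norm_eq_one hz

theorem form_self (p : ℂ[X]) : form μ p p = ((∫ z, ‖p.eval z‖ ^ 2 ∂μ : ℝ) : ℂ) := by
  unfold form
  rw [← integral_complex_ofReal]
  simp [Complex.mul_conj']

/-- The root set of `p` is closed and of full measure, so it contains the infinite support. -/
theorem eq_zero_of_form_self_eq_zero [IsFiniteMeasure μ] (hμ : ∀ᵐ z ∂μ, ‖z‖ = 1)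
    (hinf : μ.support.Infinite) {p : ℂ[X]} (h : form μ p p = 0) : p = 0 := by
  rw [form_self, Complex.ofReal_eq_zero, integral_eq_zero_iff_of_nonneg (fun z => by positivity)] at h
  · refine eq_zero_of_infinite_isRoot p (hinf.mono ?_)
    refine Measure.support_subset_of_isClosed (isClosed_singleton.preimage p.continuous) ?_
    filter_upwards [h] with z hz
    simpa using hz
  · have := (integrable_form hμ p p).norm
    refine this.congr (Filter.Eventually.of_forall fun z => ?_)
    simp [sq]

/-- A polynomial annihilated by all monomials `Xᵏ`, `a ≤ k < b`, is orthogonal to `Xᵃ q`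
for `q` of degree less than `b - a`. -/
theorem form_eq_zero_of_monomials [IsFiniteMeasure μ] (hμ : ∀ᵐ z ∂μ, ‖z‖ = 1) {p q : ℂ[X]}
    {n : ℕ} (h : ∀ k < n, form μ p (X * X ^ k) = 0) (hq : q.degree < n) :
    form μ p (X * q) = 0 := by
  rcases eq_or_ne q 0 with rfl | hq0
  · rw [mul_zero, form_zero_right]
  have hs : X * q = ∑ k ∈ Finset.range n, C (q.coeff k) * (X * X ^ k) := by
    conv_lhs => rw [q.as_sum_range' n ((natDegree_lt_iff_degree_lt hq0).2 hq)]
    rw [Finset.mul_sum]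
    refine Finset.sum_congr rfl fun k _ => ?_
    rw [← C_mul_X_pow_eq_monomial]; ring
  rw [hs, form_sum_right hμ]
  refine Finset.sum_eq_zero fun k hk => ?_
  rw [form_C_mul_right, h k (Finset.mem_range.1 hk), mul_zero]

end Form

/-! ### Szegő recurrence. -/

/-- The reversed polynomials `Φₙ*`, defined by the second half of the Szegő recurrence. -/
noncomputable def reversed (α : ℕ → ℂ) (Φ : ℕ → ℂ[X]) : ℕ → ℂ[X]
  | 0 => 1
  | n + 1 => reversed α Φ n - C (α n) * (X * Φ n)

section Szego

variable {μ : Measure ℂ} {Φ : ℕ → ℂ[X]} {α : ℕ → ℂ}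

theorem IsMonicOPUC.degree_eq (hΦ : IsMonicOPUC μ Φ) (n : ℕ) : (Φ n).degree = n := by
  rw [degree_eq_natDegree (hΦ.monic n).ne_zero, hΦ.natDegree_eq]

theorem IsMonicOPUC.zero_eq_one (hΦ : IsMonicOPUC μ Φ) : Φ 0 = 1 :=
  eq_one_of_monic_natDegree_zero (hΦ.monic 0) (hΦ.natDegree_eq 0)

theorem degree_C_mul_le (c : ℂ) (p : ℂ[X]) : (C c * p).degree ≤ p.degree := by
  rw [← smul_eq_C_mul]
  exact degree_smul_le c p

theorem degree_sub_C_coeff_mul_lt {p q : ℂ[X]} {d : ℕ} (hp : p.Monic) (hpd : p.natDegree = d)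
    (hq : q.degree < (d + 1 : ℕ)) : (q - C (q.coeff d) * p).degree < d := by
  rw [degree_lt_iff_coeff_zero]
  intro m hm
  rw [coeff_sub, coeff_C_mul]
  rcases hm.eq_or_lt with rfl | hm
  · have : p.coeff d = 1 := by rw [← hpd]; exact hp
    rw [this]; ring
  · rw [coeff_eq_zero_of_degree_lt (hq.trans_le (by exact_mod_cast hm)),
      coeff_eq_zero_of_natDegree_lt (hpd.trans_lt hm)]
    ring

theorem IsMonicOPUC.form_eq_zero [IsFiniteMeasure μ] (hμ : ∀ᵐ z ∂μ, ‖z‖ = 1)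
    (hΦ : IsMonicOPUC μ Φ) {n : ℕ} {q : ℂ[X]} (hq : q.degree < n) : form μ (Φ n) q = 0 := by
  suffices ∀ d ≤ n, ∀ q : ℂ[X], q.degree < d → form μ (Φ n) q = 0 from this n le_rfl q hq
  intro d
  induction d with
  | zero =>
    intro _ q hq
    have : q = 0 := by simpa using hq
    rw [this, form_zero_right]
  | succ d ih =>
    intro hd q hq
    have h := ih (by omega) _ (degree_sub_C_coeff_mul_lt (hΦ.monic d) (hΦ.natDegree_eq d) hq)
    have h2 : form μ (Φ n) (C (q.coeff d) * Φ d) = 0 := by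
      rw [form_C_mul_right, form, hΦ.orthogonal n d (by omega), mul_zero]
    have h3 := form_add_right hμ (Φ n) (q - C (q.coeff d) * Φ d) (C (q.coeff d) * Φ d)
    rw [sub_add_cancel, h, h2, add_zero] at h3
    exact h3

/-- On the circle, pairing `zⁿ conj Φₙ` with `zᵏ⁺¹` gives the conjugate of the pairing of `Φₙ` with
`zⁿ⁻ᵏ⁻¹`. -/
theorem form_eq_zero_of_eval_eq_reversed [IsFiniteMeasure μ] (hμ : ∀ᵐ z ∂μ, ‖z‖ = 1)
    (hΦ : IsMonicOPUC μ Φ) {n : ℕ} {p q : ℂ[X]}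
    (hp : ∀ z : ℂ, ‖z‖ = 1 → p.eval z = z ^ n * conj ((Φ n).eval z)) (hq : q.degree < n) :
    form μ p (X * q) = 0 := by
  refine form_eq_zero_of_monomials hμ (fun k hk => ?_) hq
  obtain ⟨j, rfl⟩ : ∃ j, n = j + (k + 1) := ⟨n - (k + 1), by omega⟩
  have h : form μ (Φ (j + (k + 1))) (X ^ j) = 0 := by
    refine hΦ.form_eq_zero hμ ?_
    rw [degree_X_pow]
    exact_mod_cast (by omega : j < j + (k + 1))
  rw [← form_conj, map_eq_zero] at h
  rw [← h]
  refine form_congr hμ fun z hz => ?_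
  rw [hp z hz, ← pow_succ']
  simp only [eval_pow, eval_X, map_pow]
  have h1 : conj z ^ (k + 1) * z ^ (k + 1) = 1 := by
    rw [← mul_pow, conj_mul_self_of_norm_eq_one hz, one_pow]
  rw [pow_add]
  linear_combination z ^ j * conj ((Φ (j + (k + 1))).eval z) * h1

/-- The Szegő recurrence, from the defining properties of the reversed polynomial. -/
theorem IsMonicOPUC.szego_of_reversed [IsFiniteMeasure μ] (hμ : ∀ᵐ z ∂μ, ‖z‖ = 1)
    (hinf : μ.support.Infinite) (hΦ : IsMonicOPUC μ Φ) {n : ℕ} {p : ℂ[X]}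
    (hp : ∀ z : ℂ, ‖z‖ = 1 → p.eval z = z ^ n * conj ((Φ n).eval z))
    (hdeg : p.degree ≤ n) (hp0 : p.eval 0 = 1) :
    Φ (n + 1) = X * Φ n + C ((Φ (n + 1)).eval 0) * p := by
  set c := (Φ (n + 1)).eval 0 with hc
  -- The difference is divisible by `X` and of degree at most `n`; all three terms are orthogonal to
  -- such polynomials, so it is orthogonal to itself.
  obtain ⟨q, hq⟩ : X ∣ Φ (n + 1) - X * Φ n - C c * p := by
    rw [X_dvd_iff, coeff_zero_eq_eval_zero]
    simp [hp0, hc]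
  have hXn : (X * Φ n).Monic := monic_X.mul (hΦ.monic n)
  have hXd : (X * Φ n).natDegree = n + 1 := by
    rw [natDegree_X_mul (hΦ.monic n).ne_zero, hΦ.natDegree_eq]
  have hlt : (X * q).degree < ((n + 1 : ℕ) : WithBot ℕ) := by
    rw [← hq]
    refine (degree_sub_le _ _).trans_lt (max_lt ?_ ?_)
    · have := degree_sub_lt_left (p := Φ (n + 1)) (q := X * Φ n)
        (by rw [hΦ.degree_eq, degree_eq_natDegree hXn.ne_zero, hXd]) (hΦ.monic _).ne_zero
        (by rw [hXn.leadingCoeff, (hΦ.monic _).leadingCoeff])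
      rwa [hΦ.degree_eq] at this
    · refine (degree_C_mul_le c p).trans_lt (hdeg.trans_lt ?_)
      exact_mod_cast Nat.lt_succ_self n
  have hqn : q.degree < n := by
    rcases eq_or_ne q 0 with rfl | hq0
    · simp
    · rw [← natDegree_lt_iff_degree_lt (mul_ne_zero X_ne_zero hq0), natDegree_X_mul hq0] at hlt
      exact (natDegree_lt_iff_degree_lt hq0).1 (by omega)
  have h0 : form μ (X * q) (X * q) = 0 := by
    have : form μ (Φ (n + 1) - X * Φ n - C c * p) (X * q) = 0 := by
      rw [form_sub_left hμ, form_sub_left hμ, form_C_mul_left, hΦ.form_eq_zero hμ hlt,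
        form_X_mul_X_mul hμ, hΦ.form_eq_zero hμ hqn, form_eq_zero_of_eval_eq_reversed hμ hΦ hp hqn]
      ring
    rwa [hq] at this
  have h1 := eq_zero_of_form_self_eq_zero hμ hinf h0
  rw [h1] at hq
  linear_combination hq

/-- The properties at `n` yield the recurrence for `Φ (n + 1)`, which in turn yields the properties
at `n + 1`. -/
theorem IsMonicOPUC.reversed_properties [IsFiniteMeasure μ] (hμ : ∀ᵐ z ∂μ, ‖z‖ = 1)
    (hinf : μ.support.Infinite) (hΦ : IsMonicOPUC μ Φ)
    (hα : ∀ n, α n = -conj ((Φ (n + 1)).eval 0)) (n : ℕ) :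
    (∀ z : ℂ, ‖z‖ = 1 → (reversed α Φ n).eval z = z ^ n * conj ((Φ n).eval z)) ∧
      (reversed α Φ n).degree ≤ n ∧ (reversed α Φ n).eval 0 = 1 := by
  induction n with
  | zero => simp [reversed, hΦ.zero_eq_one]
  | succ n ih =>
    obtain ⟨h1, h2, h3⟩ := ih
    refine ⟨fun z hz => ?_, ?_, by simp [reversed, h3]⟩
    · have hs := hΦ.szego_of_reversed hμ hinf h1 h2 h3
      have hzz := conj_mul_self_of_norm_eq_one hz
      have hzn : conj z ^ n * z ^ n = 1 := by rw [← mul_pow, hzz, one_pow]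
      have hαn := hα n
      obtain ⟨c, hc⟩ : ∃ c, c = (Φ (n + 1)).eval 0 := ⟨_, rfl⟩
      rw [← hc] at hs hαn
      simp only [reversed, hs, hαn, eval_sub, eval_add, eval_mul, eval_C, eval_X, map_add, map_mul, h1 z hz,
        map_pow, Complex.conj_conj, pow_succ]
      linear_combination -z ^ n * conj ((Φ n).eval z) * hzz -
        conj c * z * (Φ n).eval z * hzn
    · refine (degree_sub_le _ _).trans (max_le (h2.trans (by exact_mod_cast Nat.le_succ n)) ?_)
      refine (degree_C_mul_le _ _).trans ?_
      rw [degree_mul, degree_X, hΦ.degree_eq]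
      exact_mod_cast (by omega : 1 + n ≤ n + 1)

theorem IsMonicOPUC.szego [IsFiniteMeasure μ] (hμ : ∀ᵐ z ∂μ, ‖z‖ = 1)
    (hinf : μ.support.Infinite) (hΦ : IsMonicOPUC μ Φ)
    (hα : ∀ n, α n = -conj ((Φ (n + 1)).eval 0)) (n : ℕ) :
    Φ (n + 1) = X * Φ n - C (conj (α n)) * reversed α Φ n := by
  obtain ⟨h1, h2, h3⟩ := hΦ.reversed_properties hμ hinf hα n
  rw [hα n, map_neg, Complex.conj_conj, C_neg, neg_mul, sub_neg_eq_add]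
  exact hΦ.szego_of_reversed hμ hinf h1 h2 h3

end Szego

/-! ### Quadrature and location of the support. -/

section Quadrature

variable {μ : Measure ℂ}

/-- For unimodular `z` and `a`, `-conj a * (z - a) * conj z = conj (z - a)`: the factor `X - C a`
changes sides and absorbs `X`. -/
theorem form_eq_zero_of_eq_mul_mul (hμ : ∀ᵐ z ∂μ, ‖z‖ = 1) {P Q : ℂ[X]} {a b : ℂ}
    (ha : ‖a‖ = 1) (hP : P = (X - C a) * ((X - C b) * Q)) (h : form μ P (X * Q) = 0) :
    form μ ((X - C b) * Q) ((X - C a) * Q) = 0 := by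
  have h1 : form μ (C (-conj a) * P) (X * Q) = 0 := by rw [form_C_mul_left, h, mul_zero]
  rw [← h1]
  refine form_congr hμ fun z hz => ?_
  simp only [hP, eval_mul, eval_sub, eval_X, eval_C, map_mul, map_sub]
  linear_combination (z - b) * Q.eval z * conj (Q.eval z) *
    (-conj z * conj_mul_self_of_norm_eq_one ha + conj a * conj_mul_self_of_norm_eq_one hz)

/-- A polynomial with unimodular zeros, orthogonal to `X q` for all `q` of degree less than `n`,
has simple zeros. -/
theorem nodup_roots_of_orthogonal [IsFiniteMeasure μ] (hμ : ∀ᵐ z ∂μ, ‖z‖ = 1)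
    (hinf : μ.support.Infinite) {P : ℂ[X]} {n : ℕ} (hP0 : P ≠ 0) (hdeg : P.natDegree = n + 1)
    (hroots : ∀ w, P.eval w = 0 → ‖w‖ = 1)
    (horth : ∀ q : ℂ[X], q.degree < n → form μ P (X * q) = 0) : P.roots.Nodup := by
  rw [Multiset.nodup_iff_count_le_one]
  intro w
  rw [count_roots]
  by_contra! hw
  obtain ⟨Q, hQ⟩ := (le_rootMultiplicity_iff hP0).1 hw
  have hQ0 : Q ≠ 0 := by rintro rfl; exact hP0 (by simpa using hQ)
  have hPw : P.eval w = 0 := by simp [hQ]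
  have hQd : Q.degree < n := by
    rw [← natDegree_lt_iff_degree_lt hQ0]
    rw [hQ, natDegree_mul (pow_ne_zero _ (X_sub_C_ne_zero w)) hQ0, natDegree_pow,
      natDegree_X_sub_C] at hdeg
    omega
  have h := form_eq_zero_of_eq_mul_mul hμ (hroots w hPw)
    (by rw [hQ]; ring : P = (X - C w) * ((X - C w) * Q)) (horth Q hQd)
  exact mul_ne_zero (X_sub_C_ne_zero w) hQ0 (eq_zero_of_form_self_eq_zero hμ hinf h)

/-- Up to constants, the two basis polynomials are `(X - b)Q` and `(X - a)Q`, where `Q` is the nodal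
polynomial of the other nodes. -/
theorem form_basis_eq_zero (hμ : ∀ᵐ z ∂μ, ‖z‖ = 1) {S : Finset ℂ} {n : ℕ}
    (hcard : S.card = n + 1) (hS : ∀ w ∈ S, ‖w‖ = 1)
    (horth : ∀ q : ℂ[X], q.degree < n → form μ (Lagrange.nodal S id) (X * q) = 0)
    {a b : ℂ} (ha : a ∈ S) (hb : b ∈ S) (hab : a ≠ b) :
    form μ (Lagrange.basis S id a) (Lagrange.basis S id b) = 0 := by
  have hbasis : ∀ w ∈ S, Lagrange.basis S id w =
      C (Lagrange.nodalWeight S id w) * Lagrange.nodal (S.erase w) id := fun w hw => by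
    rw [Lagrange.basis_eq_prod_sub_inv_mul_nodal_div hw, Lagrange.nodal_erase_eq_nodal_div hw]
  set Q := Lagrange.nodal ((S.erase a).erase b) id with hQ
  have h1 : Lagrange.nodal (S.erase a) id = (X - C b) * Q :=
    Lagrange.nodal_eq_mul_nodal_erase (Finset.mem_erase.2 ⟨hab.symm, hb⟩)
  have h2 : Lagrange.nodal (S.erase b) id = (X - C a) * Q := by
    rw [hQ, Finset.erase_right_comm]
    exact Lagrange.nodal_eq_mul_nodal_erase (Finset.mem_erase.2 ⟨hab, ha⟩)
  have h3 : Lagrange.nodal S id = (X - C a) * ((X - C b) * Q) := by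
    rw [← h1]; exact Lagrange.nodal_eq_mul_nodal_erase ha
  have hQd : Q.degree < n := by
    rw [hQ, Lagrange.degree_nodal, Finset.card_erase_of_mem (Finset.mem_erase.2 ⟨hab.symm, hb⟩),
      Finset.card_erase_of_mem ha, hcard]
    have : 1 < S.card := Finset.one_lt_card.2 ⟨a, ha, b, hb, hab⟩
    exact_mod_cast (by omega : n + 1 - 1 - 1 < n)
  rw [hbasis a ha, hbasis b hb, h1, h2, form_C_mul_left, form_C_mul_right,
    form_eq_zero_of_eq_mul_mul hμ (hS a ha) h3 (horth Q hQd)]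
  ring

/-- Positive quadrature at the zeros of a para-orthogonal polynomial. -/
theorem integral_norm_sq_eq_sum [IsFiniteMeasure μ] (hμ : ∀ᵐ z ∂μ, ‖z‖ = 1) {S : Finset ℂ}
    {n : ℕ} (hcard : S.card = n + 1) (hS : ∀ w ∈ S, ‖w‖ = 1)
    (horth : ∀ q : ℂ[X], q.degree < n → form μ (Lagrange.nodal S id) (X * q) = 0)
    {q : ℂ[X]} (hq : q.degree < (n + 1 : ℕ)) :
    ∫ z, ‖q.eval z‖ ^ 2 ∂μ =
      ∑ w ∈ S, ‖q.eval w‖ ^ 2 * ∫ z, ‖(Lagrange.basis S id w).eval z‖ ^ 2 ∂μ := by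
  have hq' : q = ∑ w ∈ S, C (q.eval w) * Lagrange.basis S id w := by
    have := Lagrange.eq_interpolate (s := S) (v := id) (f := q) Function.injective_id.injOn
      (by rwa [hcard])
    rw [Lagrange.interpolate_apply] at this
    exact this
  have h : form μ q q = ∑ w ∈ S, (‖q.eval w‖ ^ 2 : ℂ) *
      form μ (Lagrange.basis S id w) (Lagrange.basis S id w) := by
    conv_lhs => rw [hq']
    rw [form_sum_left hμ]
    refine Finset.sum_congr rfl fun w hw => ?_
    rw [form_sum_right hμ, Finset.sum_eq_single_of_mem w hw]
    · rw [form_C_mul_left, form_C_mul_right, ← mul_assoc, Complex.mul_conj']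
    · intro v hv hvw
      rw [form_C_mul_left, form_C_mul_right, form_basis_eq_zero hμ hcard hS horth hw hv hvw.symm]
      ring
  simp_rw [form_self] at h
  exact_mod_cast h

theorem integral_norm_sq_le [IsFiniteMeasure μ] (hμ : ∀ᵐ z ∂μ, ‖z‖ = 1)
    (hinf : μ.support.Infinite) {P : ℂ[X]} {n : ℕ} (hP : P.Monic) (hdeg : P.natDegree = n + 1)
    (hroots : ∀ w, P.eval w = 0 → ‖w‖ = 1)
    (horth : ∀ q : ℂ[X], q.degree < n → form μ P (X * q) = 0)
    {q : ℂ[X]} (hq : q.degree < (n + 1 : ℕ)) {B : ℝ}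
    (hB : ∀ w, P.eval w = 0 → ‖q.eval w‖ ^ 2 ≤ B) :
    ∫ z, ‖q.eval z‖ ^ 2 ∂μ ≤ B * μ.real Set.univ := by
  have hnd := nodup_roots_of_orthogonal hμ hinf hP.ne_zero hdeg hroots horth
  have hmem : ∀ w ∈ P.roots.toFinset, P.eval w = 0 := fun w hw => by
    rw [Multiset.mem_toFinset, mem_roots hP.ne_zero] at hw; exact hw
  have hsplit := IsAlgClosed.splits P
  have hcard : P.roots.toFinset.card = n + 1 := by
    rw [Multiset.toFinset_card_of_nodup hnd, ← hsplit.natDegree_eq_card_roots, hdeg]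
  have hnodal : P = Lagrange.nodal P.roots.toFinset id := by
    conv_lhs => rw [hsplit.eq_prod_roots_of_monic hP]
    rw [Lagrange.nodal_eq, Finset.prod, Multiset.toFinset_val, hnd.dedup]
    rfl
  have hS : ∀ w ∈ P.roots.toFinset, ‖w‖ = 1 := fun w hw => hroots w (hmem w hw)
  have horth' : ∀ q : ℂ[X], q.degree < n →
      form μ (Lagrange.nodal P.roots.toFinset id) (X * q) = 0 := by
    rw [← hnodal]; exact horth
  -- The case `q = 1` shows that the weights add up to the total mass.
  have h1 := integral_norm_sq_eq_sum hμ hcard hS horth' (q := 1)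
    (by rw [degree_one]; exact_mod_cast Nat.succ_pos n)
  simp only [eval_one, norm_one, one_pow, one_mul, integral_const, smul_eq_mul, mul_one] at h1
  rw [integral_norm_sq_eq_sum hμ hcard hS horth' hq, h1, Finset.mul_sum]
  refine Finset.sum_le_sum fun w hw => ?_
  exact mul_le_mul_of_nonneg_right (hB w (hmem w hw)) (integral_nonneg fun z => by positivity)

theorem norm_add_sq_of_norm_eq_one {z w : ℂ} (hz : ‖z‖ = 1) (hw : ‖w‖ = 1) :
    ‖z + w‖ ^ 2 = 4 - ‖z - w‖ ^ 2 := by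
  have := parallelogram_law_with_norm ℝ z w
  rw [hz, hw] at this
  nlinarith

theorem pow_mul_measureReal_ball_le [IsFiniteMeasure μ] (hμ : ∀ᵐ z ∂μ, ‖z‖ = 1) {z₀ : ℂ}
    (hz₀ : ‖z₀‖ = 1) {r : ℝ} (hr : 0 ≤ r) (hr2 : 0 ≤ 4 - r ^ 2) (n : ℕ) :
    (4 - r ^ 2) ^ n * μ.real (Metric.ball z₀ r) ≤ ∫ z, ‖((X + C z₀) ^ n).eval z‖ ^ 2 ∂μ := by
  have hint : Integrable (fun z => ‖((X + C z₀) ^ n).eval z‖ ^ 2) μ :=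
    integrable_of_continuous (f := fun z => ‖((X + C z₀) ^ n).eval z‖ ^ 2) hμ (by fun_prop)
  have hnonneg : 0 ≤ᵐ[μ] fun z => ‖((X + C z₀) ^ n).eval z‖ ^ 2 :=
    Filter.Eventually.of_forall fun z => sq_nonneg ‖((X + C z₀) ^ n).eval z‖
  refine le_trans ?_ (setIntegral_le_integral (s := Metric.ball z₀ r) hint hnonneg)
  have hconst : (4 - r ^ 2) ^ n * μ.real (Metric.ball z₀ r) =
      ∫ _ in Metric.ball z₀ r, (4 - r ^ 2) ^ n ∂μ := by
    rw [setIntegral_const, smul_eq_mul, mul_comm]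
  rw [hconst]
  refine integral_mono_ae (integrable_const _) hint.integrableOn ?_
  filter_upwards [ae_restrict_of_ae hμ, ae_restrict_mem Metric.isOpen_ball.measurableSet]
    with z hz hzU
  rw [eval_pow, norm_pow, ← pow_mul, mul_comm, pow_mul]
  refine pow_le_pow_left₀ hr2 ?_ n
  simp only [eval_add, eval_X, eval_C]
  rw [norm_add_sq_of_norm_eq_one hz hz₀]
  rw [Metric.mem_ball, dist_eq_norm] at hzU
  nlinarith [norm_nonneg (z - z₀)]

/-- If para-orthogonal polynomials of every positive degree have their zeros in a closed set,
this set contains the support of the measure. -/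
theorem support_subset_of_zeros_subset [IsFiniteMeasure μ] (hμ : ∀ᵐ z ∂μ, ‖z‖ = 1)
    (hinf : μ.support.Infinite) {P : ℕ → ℂ[X]} (hP : ∀ n, (P n).Monic)
    (hdeg : ∀ n, (P n).natDegree = n + 1)
    (hroots : ∀ n w, (P n).eval w = 0 → ‖w‖ = 1)
    (horth : ∀ n : ℕ, ∀ q : ℂ[X], q.degree < n → form μ (P n) (X * q) = 0)
    {K : Set ℂ} (hK : IsClosed K) (hPK : ∀ n w, (P n).eval w = 0 → w ∈ K) :
    μ.support ⊆ K := by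
  intro z₀ hz₀
  by_contra hzK
  have hz₁ : ‖z₀‖ = 1 := by
    have := Measure.support_subset_of_isClosed (Metric.isClosed_sphere (x := (0 : ℂ)) (ε := 1))
      (by filter_upwards [hμ] with z hz; simpa using hz) hz₀
    simpa using this
  obtain ⟨δ, hδ, hball⟩ := Metric.isOpen_iff.1 hK.isOpen_compl z₀ hzK
  have hfar : ∀ n w, (P n).eval w = 0 → δ ≤ ‖w - z₀‖ := fun n w hw => by
    by_contra! h
    exact hball (by rwa [Metric.mem_ball, dist_eq_norm]) (hPK n w hw)
  -- Any zero of `P 0` shows `δ ≤ 2`, both points being unimodular.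
  have hA : 0 ≤ 4 - δ ^ 2 := by
    obtain ⟨w, hw⟩ := IsAlgClosed.exists_root (P 0) (by
      rw [degree_eq_natDegree (hP 0).ne_zero, hdeg 0]; simp)
    have h1 := norm_add_sq_of_norm_eq_one (hroots 0 w hw) hz₁
    have h2 := hfar 0 w hw
    nlinarith [sq_nonneg ‖w + z₀‖]
  set A := 4 - δ ^ 2 with hAdef
  -- Halving the radius makes `B > A`, so the lower bound `Bⁿ μ(U)` outgrows the upper bound `Aⁿ
  -- μ(ℂ)`.
  set B := 4 - (δ / 2) ^ 2 with hBdef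
  have hAB : A < B := by rw [hAdef, hBdef]; nlinarith
  have hupper : ∀ n : ℕ, ∫ z, ‖((X + C z₀) ^ n).eval z‖ ^ 2 ∂μ ≤ A ^ n * μ.real Set.univ := by
    intro n
    refine integral_norm_sq_le hμ hinf (hP n) (hdeg n) (hroots n) (horth n) ?_ fun w hw => ?_
    · rw [degree_pow, degree_X_add_C, nsmul_one]
      exact_mod_cast Nat.lt_succ_self n
    · rw [eval_pow, norm_pow, ← pow_mul, mul_comm, pow_mul]
      refine pow_le_pow_left₀ (sq_nonneg _) ?_ n
      simp only [eval_add, eval_X, eval_C]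
      rw [norm_add_sq_of_norm_eq_one (hroots n w hw) hz₁, hAdef]
      have := hfar n w hw
      nlinarith
  set U := Metric.ball z₀ (δ / 2) with hU
  have hUpos : 0 < μ.real U := by
    rw [measureReal_def]
    exact ENNReal.toReal_pos
      ((Measure.mem_support_iff_forall z₀).1 hz₀ _ (Metric.ball_mem_nhds z₀ (by positivity))).ne'
      (measure_ne_top μ U)
  have hlower : ∀ n : ℕ, B ^ n * μ.real U ≤ ∫ z, ‖((X + C z₀) ^ n).eval z‖ ^ 2 ∂μ := fun n => by
    rw [hU, hBdef]
    exact pow_mul_measureReal_ball_le hμ hz₁ (by positivity) (by linarith) n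
  have hB : 0 < B := hA.trans_lt hAB
  have hlim : Filter.Tendsto (fun n : ℕ => (A / B) ^ n * μ.real Set.univ) Filter.atTop
      (nhds (0 * μ.real Set.univ)) :=
    (tendsto_pow_atTop_nhds_zero_of_lt_one (div_nonneg hA hB.le)
      ((div_lt_one hB).2 hAB)).mul_const _
  rw [zero_mul] at hlim
  refine absurd (ge_of_tendsto' hlim fun n => ?_) (not_le.2 hUpos)
  rw [div_pow, div_mul_eq_mul_div, le_div_iff₀ (pow_pos hB n), mul_comm]
  exact (hlower n).trans (hupper n)

end Quadrature

/-! ### Para-orthogonal polynomials and their zeros. -/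

theorem one_sub_ne_zero_of_norm_lt_one {a : ℂ} (ha : ‖a‖ < 1) : 1 - a ≠ 0 := by
  intro h
  rw [← sub_eq_zero.1 h, norm_one] at ha
  exact lt_irrefl _ ha

theorem norm_tau {α : ℕ → ℂ} (hα : ∀ n, ‖α n‖ < 1) (n : ℕ) : ‖tau α n‖ = 1 := by
  induction n with
  | zero => simp [tau]
  | succ n ih =>
    have h1 : ‖tau α n * α n‖ < 1 := by rw [norm_mul, ih, one_mul]; exact hα n
    -- As `τ` is unimodular, the numerator is `τ` times the conjugate of the denominator.
    have h2 : tau α n - conj (α n) = tau α n * conj (1 - tau α n * α n) := by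
      simp only [map_sub, map_one, map_mul]
      linear_combination conj (α n) * conj_mul_self_of_norm_eq_one ih
    rw [tau, h2, norm_div, norm_mul, ih, one_mul, RCLike.norm_conj,
      div_self (norm_ne_zero_iff.2 (one_sub_ne_zero_of_norm_lt_one h1))]

/-- A Szegő step scales the indefinite form `|r|² - |p|²` by `1 - |a|²`, hence preserves its sign.
-/
theorem normSq_sub_normSq_szego (a p r : ℂ) :
    Complex.normSq (r - a * p) - Complex.normSq (p - conj a * r) =
      (1 - Complex.normSq a) * (Complex.normSq r - Complex.normSq p) := by
  simp only [Complex.normSq_apply, Complex.sub_re, Complex.sub_im, Complex.mul_re, Complex.mul_im,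
    Complex.conj_re, Complex.conj_im]
  ring

/-- The para-orthogonal polynomials which vanish at `1`. -/
noncomputable def paraOrthogonal (α : ℕ → ℂ) (Φ : ℕ → ℂ[X]) (n : ℕ) : ℂ[X] :=
  X * Φ n - C (tau α n) * reversed α Φ n

section Zeros

variable {α : ℕ → ℂ} {Φ : ℕ → ℂ[X]}

theorem normSq_lt_one (hα : ∀ n, ‖α n‖ < 1) (n : ℕ) : Complex.normSq (α n) < 1 := by
  rw [Complex.normSq_eq_norm_sq]
  have := hα n
  nlinarith [norm_nonneg (α n)]

theorem reversed_dominates (hα : ∀ n, ‖α n‖ < 1) (hΦ0 : Φ 0 = 1)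
    (hs : ∀ n, Φ (n + 1) = X * Φ n - C (conj (α n)) * reversed α Φ n)
    {z : ℂ} (hz : Complex.normSq z ≤ 1) (n : ℕ) :
    Complex.normSq ((Φ n).eval z) ≤ Complex.normSq ((reversed α Φ n).eval z) ∧
      (reversed α Φ n).eval z ≠ 0 := by
  induction n with
  | zero => simp [reversed, hΦ0]
  | succ n ih =>
    have h := normSq_sub_normSq_szego (α n) (z * (Φ n).eval z) ((reversed α Φ n).eval z)
    have hle : Complex.normSq (z * (Φ n).eval z) ≤ Complex.normSq ((reversed α Φ n).eval z) := by
      rw [map_mul]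
      exact (mul_le_of_le_one_left (Complex.normSq_nonneg _) hz).trans ih.1
    simp only [hs, reversed, eval_sub, eval_mul, eval_C, eval_X]
    refine ⟨?_, fun h0 => ?_⟩
    · have := mul_nonneg (sub_nonneg.2 (normSq_lt_one hα n).le) (sub_nonneg.2 hle)
      linarith
    · have h1 := Complex.normSq_pos.2 ih.2
      have h2 := congrArg Complex.normSq (sub_eq_zero.1 h0)
      rw [map_mul] at h2
      nlinarith [normSq_lt_one hα n, Complex.normSq_nonneg (α n)]

theorem dominates_reversed (hα : ∀ n, ‖α n‖ < 1) (hΦ0 : Φ 0 = 1)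
    (hs : ∀ n, Φ (n + 1) = X * Φ n - C (conj (α n)) * reversed α Φ n)
    {z : ℂ} (hz : 1 ≤ Complex.normSq z) (n : ℕ) :
    Complex.normSq ((reversed α Φ n).eval z) ≤ Complex.normSq ((Φ n).eval z) ∧
      (Φ n).eval z ≠ 0 := by
  induction n with
  | zero => simp [reversed, hΦ0]
  | succ n ih =>
    have h := normSq_sub_normSq_szego (α n) (z * (Φ n).eval z) ((reversed α Φ n).eval z)
    have hle' : Complex.normSq ((Φ n).eval z) ≤ Complex.normSq (z * (Φ n).eval z) := by
      rw [map_mul]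
      exact le_mul_of_one_le_left (Complex.normSq_nonneg _) hz
    have hle := ih.1.trans hle'
    simp only [hs, reversed, eval_sub, eval_mul, eval_C, eval_X]
    refine ⟨?_, fun h0 => ?_⟩
    · have := mul_nonneg (sub_nonneg.2 (normSq_lt_one hα n).le) (sub_nonneg.2 hle)
      linarith
    · have h1 := (Complex.normSq_pos.2 ih.2).trans_le hle'
      have h2 := congrArg Complex.normSq (sub_eq_zero.1 h0)
      rw [map_mul _ (conj (α n)), Complex.normSq_conj] at h2
      nlinarith [normSq_lt_one hα n, Complex.normSq_nonneg (α n)]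

/-- A zero forces `|zΦₙ| = |Φₙ*|`, while `Φₙ*` dominates strictly inside the disc and `zΦₙ` strictly
outside. -/
theorem norm_eq_one_of_paraOrthogonal_eval_eq_zero (hα : ∀ n, ‖α n‖ < 1) (hΦ0 : Φ 0 = 1)
    (hs : ∀ n, Φ (n + 1) = X * Φ n - C (conj (α n)) * reversed α Φ n)
    {n : ℕ} {z : ℂ} (h : (paraOrthogonal α Φ n).eval z = 0) : ‖z‖ = 1 := by
  simp only [paraOrthogonal, eval_sub, eval_mul, eval_C, eval_X] at h
  have h2 := congrArg Complex.normSq (sub_eq_zero.1 h)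
  rw [map_mul, map_mul, Complex.normSq_eq_norm_sq (tau α n), norm_tau hα, one_pow, one_mul] at h2
  have h3 : Complex.normSq z = 1 := by
    rcases lt_trichotomy (Complex.normSq z) 1 with hz | hz | hz
    · obtain ⟨h4, h5⟩ := reversed_dominates hα hΦ0 hs hz.le n
      have := Complex.normSq_pos.2 h5
      nlinarith [Complex.normSq_nonneg z]
    · exact hz
    · obtain ⟨h4, h5⟩ := dominates_reversed hα hΦ0 hs hz.le n
      have := Complex.normSq_pos.2 h5
      nlinarith
  rw [Complex.normSq_eq_norm_sq] at h3
  nlinarith [norm_nonneg z]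

end Zeros

section Measure

variable {μ : Measure ℂ} {Φ : ℕ → ℂ[X]} {α : ℕ → ℂ}

theorem IsMonicOPUC.paraOrthogonal_monic_natDegree (hΦ : IsMonicOPUC μ Φ) {n : ℕ}
    (hdeg : (reversed α Φ n).degree ≤ n) :
    (paraOrthogonal α Φ n).Monic ∧ (paraOrthogonal α Φ n).natDegree = n + 1 := by
  have hm : (X * Φ n).Monic := monic_X.mul (hΦ.monic n)
  have hXd : (X * Φ n).natDegree = n + 1 := by
    rw [natDegree_X_mul (hΦ.monic n).ne_zero, hΦ.natDegree_eq]
  have hlt : (C (tau α n) * reversed α Φ n).degree < (X * Φ n).degree := by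
    rw [degree_eq_natDegree hm.ne_zero, hXd]
    exact (degree_C_mul_le _ _).trans_lt (hdeg.trans_lt (by exact_mod_cast Nat.lt_succ_self n))
  exact ⟨hm.sub_of_left hlt, by rw [paraOrthogonal, natDegree_eq_of_degree_eq (degree_sub_eq_left_of_degree_lt hlt), hXd]⟩

theorem IsMonicOPUC.form_paraOrthogonal [IsFiniteMeasure μ] (hμ : ∀ᵐ z ∂μ, ‖z‖ = 1)
    (hΦ : IsMonicOPUC μ Φ) {n : ℕ}
    (hrev : ∀ z : ℂ, ‖z‖ = 1 → (reversed α Φ n).eval z = z ^ n * conj ((Φ n).eval z))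
    {q : ℂ[X]} (hq : q.degree < n) : form μ (paraOrthogonal α Φ n) (X * q) = 0 := by
  rw [paraOrthogonal, form_sub_left hμ, form_C_mul_left, form_X_mul_X_mul hμ,
    hΦ.form_eq_zero hμ hq, form_eq_zero_of_eval_eq_reversed hμ hΦ hrev hq]
  ring

end Measure

/-! ### Riccati recurrence and chain sequence comparison. -/

section Gap

/-- The two sides are conjugate to each other, so only the imaginary part carries information; its
vanishing is `hy`. -/
theorem riccati_identity {w : ℂ} {t y y' : ℝ}
    (hy : (t - y') * (((1 - w.re) ^ 2 + w.im ^ 2) * y + 2 * w.im +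
      (1 - w.re ^ 2 - w.im ^ 2) * t) = (1 - w.re ^ 2 - w.im ^ 2) * (1 + t ^ 2)) :
    (t + Complex.I) * ((y + Complex.I) - conj w * (y - Complex.I)) * (1 - w) * (y' - Complex.I) =
      (1 - conj w) * ((y - Complex.I) - w * (y + Complex.I)) * (y' + Complex.I) *
        (t - Complex.I) := by
  apply Complex.ext
  · simp only [Complex.sub_re, Complex.sub_im, Complex.add_re, Complex.add_im, Complex.mul_re,
      Complex.mul_im, Complex.I_re, Complex.I_im, Complex.ofReal_re, Complex.ofReal_im,
      Complex.conj_re, Complex.conj_im, Complex.one_re, Complex.one_im]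
    ring
  · simp only [Complex.sub_re, Complex.sub_im, Complex.add_re, Complex.add_im, Complex.mul_re,
      Complex.mul_im, Complex.I_re, Complex.I_im, Complex.ofReal_re, Complex.ofReal_im,
      Complex.conj_re, Complex.conj_im, Complex.one_re, Complex.one_im]
    linear_combination -2 * hy

theorem ofReal_sub_I_ne_zero (t : ℝ) : (t : ℂ) - Complex.I ≠ 0 := fun h => by
  simpa using congrArg Complex.im h

/-- One step of the Riccati recurrence for the cotangent coordinate `y` of
`z Φₙ(z) / (τₙ Φₙ*(z))`. -/
theorem riccati_step {z τ a p r : ℂ} {t y y' : ℝ} (hz : z * (t - Complex.I) = t + Complex.I)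
    (hτ : conj τ * τ = 1) (ha : 1 - τ * a ≠ 0)
    (h : p * (y - Complex.I) = τ * r * (y + Complex.I))
    (hy : (t - y') * (((1 - (τ * a).re) ^ 2 + (τ * a).im ^ 2) * y + 2 * (τ * a).im +
      (1 - (τ * a).re ^ 2 - (τ * a).im ^ 2) * t) =
        (1 - (τ * a).re ^ 2 - (τ * a).im ^ 2) * (1 + t ^ 2)) :
    z * (p - conj a * r) * (y' - Complex.I) =
      (τ - conj a) / (1 - τ * a) * (r - a * p) * (y' + Complex.I) := by
  have hid := riccati_identity hy
  have hconj : conj a = τ * conj (τ * a) := by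
    rw [map_mul]; linear_combination -conj a * hτ
  rw [div_mul_eq_mul_div, div_mul_eq_mul_div, eq_div_iff ha]
  refine mul_right_cancel₀ (mul_ne_zero (ofReal_sub_I_ne_zero t) (ofReal_sub_I_ne_zero y)) ?_
  rw [hconj]
  generalize conj (τ * a) = v at hid
  linear_combination (p - τ * v * r) * (y' - Complex.I) * (1 - τ * a) * (y - Complex.I) * hz +
    ((t + Complex.I) * (y' - Complex.I) * (1 - τ * a) +
      (τ - τ * v) * a * (y' + Complex.I) * (t - Complex.I)) * h + τ * r * hid

/-- With `u = δ/m` and `u' = δ'/m'` the recurrence reads `u'(1 - (1 - g)u) = gs/(mm') ≤ g`. If `0 ≤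
u ≤ 1`, the bracket is at least `g`, so `0 ≤ u' ≤ 1`. Products replace quotients since `m` may have
either sign and `m = 0` needs no separate case. -/
theorem riccati_bound {g m m' δ s : ℝ} (hg : 0 < g) (hg1 : g ≤ 1) (hs : 0 < s)
    (hmm : s ≤ m * m') (h0 : 0 ≤ δ * m) (h1 : δ * m ≤ m ^ 2) :
    ∃ δ' : ℝ, δ' * (m - (1 - g) * δ) = g * s ∧ 0 ≤ δ' * m' ∧ δ' * m' ≤ m' ^ 2 := by
  have hm : m ≠ 0 := by rintro rfl; linarith
  have hD : g * m ^ 2 ≤ m * (m - (1 - g) * δ) := by nlinarith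
  have hDpos : 0 < m * (m - (1 - g) * δ) := lt_of_lt_of_le (by positivity) hD
  have hD0 : m - (1 - g) * δ ≠ 0 := right_ne_zero_of_mul hDpos.ne'
  have heq : g * s / (m - (1 - g) * δ) * m' = g * s * (m * m') / (m * (m - (1 - g) * δ)) := by
    field_simp
  have hmm0 : 0 ≤ m * m' := hs.le.trans hmm
  refine ⟨g * s / (m - (1 - g) * δ), div_mul_cancel₀ _ hD0, ?_, ?_⟩
  · rw [heq]; positivity
  · rw [heq, div_le_iff₀ hDpos]
    calc g * s * (m * m') ≤ g * (m * m') * (m * m') := by gcongr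
      _ = m' ^ 2 * (g * m ^ 2) := by ring
      _ ≤ m' ^ 2 * (m * (m - (1 - g) * δ)) := by gcongr

variable {α : ℕ → ℂ} {Φ : ℕ → ℂ[X]}

theorem exists_cotangent_coordinate (hα : ∀ n, ‖α n‖ < 1) (hΦ0 : Φ 0 = 1)
    (hs : ∀ n, Φ (n + 1) = X * Φ n - C (conj (α n)) * reversed α Φ n)
    {z : ℂ} {t : ℝ} (hz : z * (t - Complex.I) = t + Complex.I)
    (hc : ∀ n, t * (cCoeff α n + cCoeff α (n + 1)) ≤ cCoeff α n * cCoeff α (n + 1) - 1) (n : ℕ) :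
    ∃ y : ℝ, z * (Φ n).eval z * (y - Complex.I) =
        tau α n * (reversed α Φ n).eval z * (y + Complex.I) ∧
      0 ≤ (t - y) * (t - cCoeff α n) ∧ (t - y) * (t - cCoeff α n) ≤ (t - cCoeff α n) ^ 2 := by
  induction n with
  | zero =>
    -- At `n = 0` the quotient is `z` itself, so `y = t` and `δ = 0`.
    refine ⟨t, ?_, by simp, by simpa using sq_nonneg (t - cCoeff α 0)⟩
    simpa [hΦ0, reversed, tau] using hz
  | succ n ih =>
    obtain ⟨y, hy, h0, h1⟩ := ih
    have hτ := norm_tau hα n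
    have hw : ‖tau α n * α n‖ < 1 := by rw [norm_mul, hτ, one_mul]; exact hα n
    have hcn : cCoeff α n = -(tau α n * α n).im / (1 - (tau α n * α n).re) := rfl
    set w := tau α n * α n with hwdef
    have hsq : w.re ^ 2 + w.im ^ 2 < 1 := by
      have : ‖w‖ ^ 2 < 1 := by nlinarith [norm_nonneg w]
      rw [← Complex.normSq_eq_norm_sq, Complex.normSq_apply] at this
      linarith
    have he : 0 < 1 - w.re := by nlinarith [sq_nonneg w.im, sq_nonneg (w.re - 1)]
    have hce : cCoeff α n * (1 - w.re) = -w.im := by rw [hcn, div_mul_cancel₀ _ he.ne']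
    -- Dividing the Riccati recurrence by `2(1 - Re w)` leaves this `g`; `1 - g` is then `|1 -
    -- w|²/(2(1 - Re w)) ≥ 0`.
    set g := (1 - w.re ^ 2 - w.im ^ 2) / (2 * (1 - w.re)) with hgdef
    have hge : g * (2 * (1 - w.re)) = 1 - w.re ^ 2 - w.im ^ 2 :=
      div_mul_cancel₀ _ (by positivity)
    have hg : 0 < g := div_pos (by linarith) (by positivity)
    have hg1 : g ≤ 1 := by
      rw [hgdef, div_le_one (by positivity)]
      nlinarith [sq_nonneg w.im, sq_nonneg (w.re - 1)]
    clear_value g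
    obtain ⟨δ', h2, h3, h4⟩ := riccati_bound (m' := t - cCoeff α (n + 1)) hg hg1
      (by positivity : 0 < 1 + t ^ 2) (by nlinarith [hc n]) h0 h1
    refine ⟨t - δ', ?_, by simpa using h3, by simpa using h4⟩
    have hstep := riccati_step (y' := t - δ') hz (conj_mul_self_of_norm_eq_one hτ)
      (one_sub_ne_zero_of_norm_lt_one hw) hy (by
        rw [← hwdef]
        linear_combination 2 * (1 - w.re) * h2 + (1 + t ^ 2 - δ' * (t - y)) * hge + 2 * δ' * hce)
    rw [hs]
    simp only [reversed, tau, eval_sub, eval_mul, eval_C, eval_X]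
    exact hstep

theorem paraOrthogonal_eval_ne_zero (hα : ∀ n, ‖α n‖ < 1) (hΦ0 : Φ 0 = 1)
    (hs : ∀ n, Φ (n + 1) = X * Φ n - C (conj (α n)) * reversed α Φ n)
    {z : ℂ} {t : ℝ} (hz : z * (t - Complex.I) = t + Complex.I) (hz1 : ‖z‖ = 1)
    (hc : ∀ n, t * (cCoeff α n + cCoeff α (n + 1)) ≤ cCoeff α n * cCoeff α (n + 1) - 1) (n : ℕ) :
    (paraOrthogonal α Φ n).eval z ≠ 0 := by
  intro h
  obtain ⟨y, hy, -⟩ := exists_cotangent_coordinate hα hΦ0 hs hz hc n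
  simp only [paraOrthogonal, eval_sub, eval_mul, eval_C, eval_X] at h
  -- At a zero, `y - i` and `y + i` would have the same nonzero multiple `τₙΦₙ*(z)`.
  have h1 : tau α n * (reversed α Φ n).eval z * (2 * Complex.I) = 0 := by
    linear_combination (y - Complex.I) * h - hy
  have hr := (reversed_dominates hα hΦ0 hs (z := z)
    (by rw [Complex.normSq_eq_norm_sq, hz1]; norm_num) n).2
  have hτ : tau α n ≠ 0 := norm_ne_zero_iff.1 (by rw [norm_tau hα]; exact one_ne_zero)
  exact mul_ne_zero (mul_ne_zero hτ hr) (mul_ne_zero two_ne_zero Complex.I_ne_zero) h1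

end Gap

/-! ### Angles, cotangents and the conclusion. -/

theorem isClosed_closedArc (ϑ₁ ϑ₂ : ℝ) : IsClosed (closedArc ϑ₁ ϑ₂) := by
  have h : closedArc ϑ₁ ϑ₂ =
      (fun θ : ℝ => Complex.exp (θ * Complex.I)) '' Set.Icc ϑ₁ ϑ₂ := by
    ext z
    simp [closedArc, and_assoc, eq_comm]
  rw [h]
  exact (isCompact_Icc.image (by fun_prop)).isClosed

theorem exists_angle_of_norm_eq_one {z : ℂ} (hz : ‖z‖ = 1) :
    ∃ θ : ℝ, 0 ≤ θ ∧ θ < 2 * Real.pi ∧ z = Complex.exp (θ * Complex.I) := by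
  have harg : z = Complex.exp (z.arg * Complex.I) := by
    have := Complex.norm_mul_exp_arg_mul_I z
    rw [hz, Complex.ofReal_one, one_mul] at this
    exact this.symm
  have h1 := Complex.neg_pi_lt_arg z
  have h2 := Complex.arg_le_pi z
  have hpi := Real.pi_pos
  rcases le_or_gt 0 z.arg with h | h
  · exact ⟨z.arg, h, by linarith, harg⟩
  · refine ⟨z.arg + 2 * Real.pi, by linarith, by linarith, ?_⟩
    conv_lhs => rw [harg, ← Complex.exp_periodic]
    push_cast
    ring_nf

theorem exp_mul_cot_sub_I {θ : ℝ} (h0 : 0 < θ) (h1 : θ < 2 * Real.pi) :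
    Complex.exp (θ * Complex.I) * ((Real.cot (θ / 2) : ℝ) - Complex.I) =
      (Real.cot (θ / 2) : ℝ) + Complex.I := by
  have hs : ((Real.sin (θ / 2) : ℝ) : ℂ) ≠ 0 :=
    Complex.ofReal_ne_zero.2 (Real.sin_pos_of_pos_of_lt_pi (by linarith) (by linarith)).ne'
  have hsc : ((Real.sin (θ / 2) : ℝ) : ℂ) ^ 2 + ((Real.cos (θ / 2) : ℝ) : ℂ) ^ 2 = 1 := by
    exact_mod_cast Real.sin_sq_add_cos_sq (θ / 2)
  -- Half-angle form: `e^{iθ} = (c + is)²` with `c² + s² = 1` equals `(c + is)/(c - is)`.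
  have he : Complex.exp (θ * Complex.I) =
      ((Real.cos (θ / 2) : ℝ) + (Real.sin (θ / 2) : ℝ) * Complex.I) ^ 2 := by
    rw [Complex.ofReal_cos, Complex.ofReal_sin, ← Complex.exp_mul_I, ← Complex.exp_nat_mul]
    push_cast
    ring_nf
  rw [Real.cot_eq_cos_div_sin, he, Complex.ofReal_div]
  generalize ((Real.sin (θ / 2) : ℝ) : ℂ) = s at hs hsc
  generalize ((Real.cos (θ / 2) : ℝ) : ℂ) = c at hsc
  field_simp
  linear_combination (c + s * Complex.I) * hsc -
    (c + s * Complex.I) * s ^ 2 * Complex.I_sq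

theorem cot_le_cot_of_le {a b : ℝ} (ha : 0 < a) (hab : a ≤ b) (hb : b < Real.pi) :
    Real.cot b ≤ Real.cot a := by
  have hsa := Real.sin_pos_of_pos_of_lt_pi ha (hab.trans_lt hb)
  have hsb := Real.sin_pos_of_pos_of_lt_pi (ha.trans_le hab) hb
  rw [Real.cot_eq_cos_div_sin, Real.cot_eq_cos_div_sin, div_le_div_iff₀ hsb hsa]
  have := Real.sin_nonneg_of_nonneg_of_le_pi (sub_nonneg.2 hab) (by linarith : b - a ≤ Real.pi)
  rw [Real.sin_sub] at this
  linarith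

/-- The support of `μ` lies in every closed set which contains all points `exp (i θ)`,
`0 ≤ θ < 2π`, except possibly those where the chain sequence comparison applies. -/
theorem support_subset_of_cot {α : ℕ → ℂ} (hα : ∀ n, ‖α n‖ < 1) {μ : Measure ℂ}
    [IsFiniteMeasure μ] (hcircle : μ (Metric.sphere (0 : ℂ) 1)ᶜ = 0) (hinf : μ.support.Infinite)
    (hμα : HasVerblunskyCoefficients μ α) {K : Set ℂ} (hK : IsClosed K)
    (h : ∀ θ : ℝ, 0 ≤ θ → θ < 2 * Real.pi → Complex.exp (θ * Complex.I) ∈ K ∨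
      0 < θ ∧ ∀ n, Real.cot (θ / 2) * (cCoeff α n + cCoeff α (n + 1)) ≤
        cCoeff α n * cCoeff α (n + 1) - 1) : μ.support ⊆ K := by
  have hμ : ∀ᵐ z ∂μ, ‖z‖ = 1 := by
    filter_upwards [compl_mem_ae_iff.2 hcircle] with z hz
    simpa using hz
  obtain ⟨Φ, hΦ, hΦα⟩ := hμα
  have hrev := fun n => hΦ.reversed_properties hμ hinf hΦα n
  have hs := fun n => hΦ.szego hμ hinf hΦα n
  have hdeg := fun n => hΦ.paraOrthogonal_monic_natDegree (hrev n).2.1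
  have hroots : ∀ n w, (paraOrthogonal α Φ n).eval w = 0 → ‖w‖ = 1 := fun n w hw =>
    norm_eq_one_of_paraOrthogonal_eval_eq_zero hα hΦ.zero_eq_one hs hw
  refine support_subset_of_zeros_subset hμ hinf (fun n => (hdeg n).1) (fun n => (hdeg n).2) hroots
    (fun n q hq => hΦ.form_paraOrthogonal hμ (hrev n).1 hq) hK fun n w hw => ?_
  obtain ⟨θ, h0, h1, rfl⟩ := exists_angle_of_norm_eq_one (hroots n w hw)
  rcases h θ h0 h1 with h2 | ⟨h2, h3⟩
  · exact h2
  · exact absurd hw (paraOrthogonal_eval_ne_zero hα hΦ.zero_eq_one hs (exp_mul_cot_sub_I h2 h1)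
      (hroots n _ hw) h3 n)

end OPUC

theorem mainTheorem10 (α : ℕ → ℂ) (hα : ∀ n, ‖α n‖ < 1)
    (μ : Measure ℂ) [IsFiniteMeasure μ]
    (hcircle : μ (Metric.sphere (0 : ℂ) 1)ᶜ = 0) (hμ : μ.support.Infinite)
    (hμα : OPUC.HasVerblunskyCoefficients μ α) :
    ((∀ n, 0 < OPUC.cCoeff α n + OPUC.cCoeff α (n + 1)) →
      ∀ ϑ₂ : ℝ, 0 < ϑ₂ → ϑ₂ ≤ 2 * Real.pi →
        -- for `ϑ₂ = 2π` the cotangent is `-∞` and the condition is void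
        (ϑ₂ < 2 * Real.pi → ∀ n,
          Real.cot (ϑ₂ / 2) ≤ (OPUC.cCoeff α n * OPUC.cCoeff α (n + 1) - 1) /
            (OPUC.cCoeff α n + OPUC.cCoeff α (n + 1))) →
        μ.support ⊆ OPUC.closedArc 0 ϑ₂) ∧
    ((∀ n, OPUC.cCoeff α n + OPUC.cCoeff α (n + 1) < 0) →
      ∀ ϑ₁ : ℝ, 0 ≤ ϑ₁ → ϑ₁ < 2 * Real.pi →
        -- for `ϑ₁ = 0` the cotangent is `+∞` and the condition is void
        (0 < ϑ₁ → ∀ n,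
          (OPUC.cCoeff α n * OPUC.cCoeff α (n + 1) - 1) /
            (OPUC.cCoeff α n + OPUC.cCoeff α (n + 1)) ≤ Real.cot (ϑ₁ / 2)) →
        μ.support ⊆ OPUC.closedArc ϑ₁ (2 * Real.pi)) := by

  refine ⟨fun hpos ϑ₂ h0 _ hcot => ?_, fun hneg ϑ₁ _ h2 hcot => ?_⟩
  · refine OPUC.support_subset_of_cot hα hcircle hμ hμα (OPUC.isClosed_closedArc 0 ϑ₂)
      fun θ hθ0 hθ1 => ?_
    rcases le_or_gt θ ϑ₂ with hle | hlt
    · exact Or.inl ⟨θ, hθ0, hle, rfl⟩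
    · refine Or.inr ⟨h0.trans hlt, fun n => (le_div_iff₀ (hpos n)).1 ?_⟩
      exact (OPUC.cot_le_cot_of_le (by linarith) (by linarith) (by linarith)).trans
        (hcot (hlt.trans hθ1) n)
  · refine OPUC.support_subset_of_cot hα hcircle hμ hμα
      (OPUC.isClosed_closedArc ϑ₁ (2 * Real.pi)) fun θ hθ0 hθ1 => ?_
    rcases hθ0.eq_or_lt with rfl | hθ0
    -- The point `1`, a zero of every `Pₙ`, lies in this arc as its endpoint `θ = 2π`.
    · refine Or.inl ⟨2 * Real.pi, h2.le, le_rfl, ?_⟩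
      push_cast
      rw [Complex.exp_two_pi_mul_I, zero_mul, Complex.exp_zero]
    rcases le_or_gt ϑ₁ θ with hle | hlt
    · exact Or.inl ⟨θ, hle, hθ1.le, rfl⟩
    · refine Or.inr ⟨hθ0, fun n => (div_le_iff_of_neg (hneg n)).1 ?_⟩
      exact (hcot (hθ0.trans hlt) n).trans
        (OPUC.cot_le_cot_of_le (by linarith) (by linarith) (by linarith))
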